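/- Throughout, $2^\omega$ is Cantor space, $\langle p,q\rangle$ is the effective join of $p,q\in 2^\omega$ (with $\langle p,q\rangle(2n)=p(n)$ and $\langle p,q\rangle(2n+1)=q(n)$), and $\langle i,p\rangle=\langle\{i\},p\rangle$ for $i<2$, where sets of natural numbers are identified with their characteristic functions. A partial multifunction $f:\subseteq 2^\omega\rightrightarrows 2^\omega$ assigns to every $p$ a set $f(p)\subseteq 2^\omega$, with $\operatorname{dom}(f)=\{p: f(p)\neq\emptyset\}$. A partial function $F:\subseteq 2^\omega\to 2^\omega$ is a realizer of $f$, written $F\vdash f$, if $F(p)$ is defined and $F(p)\in f(p)$ for all $p\in\operatorname{dom}(f)$. One writes $f\le_{\mathrm{sW}} g$ ($f$ is strongly Weihrauch reducible to $g$) if there are Turing functionals $\Phi,\Psi:\subseteq 2^\omega\to 2^\omega$ such that $\Psi\circ G\circ\Phi\vdash f$ for all $G\vdash g$. The strong Weihrauch degrees are the equivalence classes of partial multifunctions on $2^\omega$ under $\le_{\mathrm{sW}}\cap\ge_{\mathrm{sW}}$, ordered by $\le_{\mathrm{sW}}$. A total monotone approximation is a set $a\subseteq\omega$ all of whose elements are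 of the form $\langle n,s,i\rangle$ with $i<2$, which contains exactly one such triple for every $n$, and for which $\langle m,s,i\rangle,\langle n,t,j\rangle\in a$ and $m<n$ imply $s<t$. For such $a$ let $\mathrm e(a)\in 2^\omega$ be given by $\mathrm e(a)(n)=i$ iff $\langle n,s,i\rangle\in a$ for some $s$; for other $a$ let $\mathrm e(a)$ be undefined. The strong Weihrauch degrees form a lattice, the strong Weihrauch lattice, in which the join of the degrees of $f$ and $g$ is the degree of $f\boxplus g$ and their meet is the degree of $f\sqcap g$, where $$(f\boxplus g)(\langle 0,p\rangle)=\{\langle a,b\rangle: \mathrm e(a)\text{ is defined and } \mathrm e(a)\in f(p)\},\qquad (f\boxplus g)(\langle 1,p\rangle)=\{\langle a,b\rangle: \mathrm e(b)\text{ is defined and } \mathrm e(b)\in g(p)\},$$ $$(f\sqcap g)(\langle p_0,p_1\rangle)=\{\langle 0,q\rangle: q\in f(p_0)\}\cup\{\langle 1,q\rangle: q\in g(p_1)\}\qquad\text{for } p_0\in\operatorname{dom}(f),\ p_1\in\operatorname{dom}(g),$$ and both are undefined at all other points. **Corollary.** Every countable distributive lattice embeds into the strong Weihrauch lattice: for every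 countable distributive lattice $L$ there is an injective map from $L$ to the strong Weihrauch degrees that preserves binary joins and binary meets. -/

import Mathlib

/-! ## Cantor space and Turing functionals -/

/-- Cantor space `2^ω`; a point is identified with the subset of `ℕ` on which it is `true`. -/
abbrev Cantor : Type := ℕ → Bool

/-- The partial recursive functionals `T^p(n)` of a number `n` and an oracle `p ∈ 2^ω`: the least
class that contains zero, successor, the projections of the pairing function and the oracle, and is
closed under pairing, composition, primitive recursion and minimization, uniformly in `p`. -/
inductive OracleRec : (Cantor → ℕ →. ℕ) → Prop
  | zero : OracleRec fun _ _ => Part.some 0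
  | succ : OracleRec fun _ n => Part.some (n + 1)
  | left : OracleRec fun _ n => Part.some (Nat.unpair n).1
  | right : OracleRec fun _ n => Part.some (Nat.unpair n).2
  | oracle : OracleRec fun p n => Part.some (p n).toNat
  | pair {f h : Cantor → ℕ →. ℕ} : OracleRec f → OracleRec h →
      OracleRec fun p n => (f p n).bind fun a => (h p n).map fun b => Nat.pair a b
  | comp {f h : Cantor → ℕ →. ℕ} : OracleRec f → OracleRec h →
      OracleRec fun p n => (h p n).bind fun a => f p a
  | prec {f h : Cantor → ℕ →. ℕ} : OracleRec f → OracleRec h →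
      OracleRec fun p m =>
        Nat.rec (f p (Nat.unpair m).1)
          (fun y IH => IH.bind fun i => h p (Nat.pair (Nat.unpair m).1 (Nat.pair y i)))
          (Nat.unpair m).2
  | rfind {f : Cantor → ℕ →. ℕ} : OracleRec f →
      OracleRec fun p a => Nat.rfind fun n => (f p (Nat.pair a n)).map fun m => decide (m = 0)

/-- `F :⊆ 2^ω → 2^ω` is a Turing functional: some oracle program `T` computes it, where `F(p)` is
defined, with value `q`, precisely if `T^p` is total with values `q(n) ∈ {0,1}`. -/
def IsTuringFunctional (F : Cantor →. Cantor) : Prop :=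
  ∃ T, OracleRec T ∧ ∀ p q, q ∈ F p ↔ ∀ n, (q n).toNat ∈ T p n

/-! ## Problems and strong Weihrauch reducibility -/

/-- A partial multifunction `f :⊆ 2^ω ⇉ 2^ω`, given by its sets of values; `f` is undefined
at `p` if `f(p)` is empty. -/
@[ext]
structure Problem : Type where
  /-- The set `f(p)` of solutions of the instance `p`. -/
  sol : Cantor → Set Cantor

namespace Problem

/-- The domain of a partial multifunction. -/
def dom (f : Problem) : Set Cantor := {p | (f.sol p).Nonempty}

/-- The partial function `F` is a realizer of `f`. -/
def Realizes (F : Cantor →. Cantor) (f : Problem) : Prop :=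
  ∀ p ∈ f.dom, ∃ q ∈ F p, q ∈ f.sol p

/-- Strong Weihrauch reducibility `f ≤_sW g`: there are Turing functionals `Φ`, `Ψ` such that
`Ψ ∘ G ∘ Φ` realizes `f` whenever `G` realizes `g`. -/
def SWReducible (f g : Problem) : Prop :=
  ∃ Φ Ψ : Cantor →. Cantor, IsTuringFunctional Φ ∧ IsTuringFunctional Ψ ∧
    ∀ G : Cantor →. Cantor, Realizes G g → Realizes (Ψ.comp (G.comp Φ)) f

end Problem

/-! ## The lattice operations on problems -/

/-- The effective join `⟨p, q⟩` of two points of Cantor space. -/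
def cjoin (p q : Cantor) : Cantor := fun n => if n % 2 = 0 then p (n / 2) else q (n / 2)

/-- The singleton `{i}` as a point of Cantor space, so that `cjoin (tag i) p` is `⟨i, p⟩`. -/
def tag (i : ℕ) : Cantor := fun n => decide (n = i)

/-- The triple `⟨n, s, i⟩`. -/
def triple (n s i : ℕ) : ℕ := Nat.pair n (Nat.pair s i)

/-- Monotone approximations. -/
structure IsMonotoneApprox (a : Cantor) : Prop where
  form : ∀ m, a m = true → ∃ n s i, i < 2 ∧ m = triple n s i
  unique : ∀ n s t i j, i < 2 → j < 2 → a (triple n s i) = true → a (triple n t j) = true →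
    s = t ∧ i = j
  mono : ∀ m n s t i j, i < 2 → j < 2 → a (triple m s i) = true → a (triple n t j) = true →
    m < n → s < t

/-- A total monotone approximation. -/
def IsTotalMonotoneApprox (a : Cantor) : Prop :=
  IsMonotoneApprox a ∧ ∀ n, ∃ s i, i < 2 ∧ a (triple n s i) = true

open Classical in
/-- The evaluation map `e`, whose domain consists of the total monotone approximations:
`e(a)(n) = i` if and only if `⟨n, s, i⟩ ∈ a` for some `s`. -/
noncomputable def approxEval : Cantor →. Cantor := fun a =>
  ⟨IsTotalMonotoneApprox a, fun _ n => decide (∃ s, a (triple n s 1) = true)⟩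

namespace Problem

/-- The join operation `f ⊞ g`. An instance is `⟨0, p⟩` with `p ∈ dom f` or `⟨1, p⟩` with
`p ∈ dom g`. A point `⟨a, b⟩` names the pair `(e(a), e(b))`, where a component is read as the
additional point `∞` if `e` is undefined there; it solves `⟨0, p⟩` if `e(a)` is defined and
belongs to `f(p)`, and it solves `⟨1, p⟩` if `e(b)` is defined and belongs to `g(p)`. -/
def boxplus (f g : Problem) : Problem where
  sol r := {w | ∃ a b, w = cjoin a b ∧
    ((∃ p, r = cjoin (tag 0) p ∧ ∃ y ∈ approxEval a, y ∈ f.sol p) ∨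
     (∃ p, r = cjoin (tag 1) p ∧ ∃ y ∈ approxEval b, y ∈ g.sol p))}

/-- The meet operation `f ⊓ g`: an instance is `⟨p₀, p₁⟩` with `p₀ ∈ dom f` and `p₁ ∈ dom g`, and
its solutions are `⟨0, q⟩` for `q ∈ f(p₀)` and `⟨1, q⟩` for `q ∈ g(p₁)`. -/
def meet (f g : Problem) : Problem where
  sol r := {w | ∃ p₀ ∈ f.dom, ∃ p₁ ∈ g.dom, r = cjoin p₀ p₁ ∧
    ((∃ q ∈ f.sol p₀, w = cjoin (tag 0) q) ∨ (∃ q ∈ g.sol p₁, w = cjoin (tag 1) q))}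

end Problem

/-! ## Closure properties of the partial recursive functionals -/

/-- Total oracle-recursive functions. -/
def TotalRec (F : Cantor → ℕ → ℕ) : Prop := OracleRec fun p n => Part.some (F p n)

theorem OracleRec.of_eq {S T : Cantor → ℕ →. ℕ} (hS : OracleRec S) (h : ∀ p n, S p n = T p n) :
    OracleRec T := by
  have : S = T := by funext p n; exact h p n
  exact this ▸ hS

theorem OracleRec.of_partrec {f : ℕ →. ℕ} (hf : Nat.Partrec f) : OracleRec fun _ => f := by
  induction hf with
  | zero => exact OracleRec.zero
  | succ => exact OracleRec.succ
  | left => exact OracleRec.left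
  | right => exact OracleRec.right
  | pair _ _ h1 h2 =>
    refine (OracleRec.pair h1 h2).of_eq fun p n => ?_
    simp [Seq.seq, Part.bind_map]
  | comp _ _ h1 h2 => exact OracleRec.comp h1 h2
  | prec _ _ h1 h2 => exact OracleRec.prec h1 h2
  | rfind _ h => exact OracleRec.rfind h

namespace TotalRec

theorem of_eq {F G : Cantor → ℕ → ℕ} (hF : TotalRec F) (h : ∀ p n, F p n = G p n) :
    TotalRec G := by
  have : F = G := by funext p n; exact h p n
  exact this ▸ hF

theorem of_computable {f : ℕ → ℕ} (hf : Computable f) : TotalRec fun _ n => f n :=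
  OracleRec.of_partrec (Partrec.nat_iff.1 hf.partrec)

theorem oracle : TotalRec fun p n => (p n).toNat := OracleRec.oracle

theorem comp {F G : Cantor → ℕ → ℕ} (hF : TotalRec F) (hG : TotalRec G) :
    TotalRec fun p n => F p (G p n) :=
  (OracleRec.comp hF hG).of_eq fun p n => by simp

theorem pair {F G : Cantor → ℕ → ℕ} (hF : TotalRec F) (hG : TotalRec G) :
    TotalRec fun p n => Nat.pair (F p n) (G p n) :=
  (OracleRec.pair hF hG).of_eq fun p n => by simp

theorem comp₂ {f : ℕ → ℕ → ℕ} (hf : Computable₂ f) {F G : Cantor → ℕ → ℕ} (hF : TotalRec F)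
    (hG : TotalRec G) : TotalRec fun p n => f (F p n) (G p n) := by
  have h : Computable fun m : ℕ => f m.unpair.1 m.unpair.2 :=
    hf.comp (Computable.fst.comp Computable.unpair) (Computable.snd.comp Computable.unpair)
  exact ((of_computable h).comp (hF.pair hG)).of_eq fun p n => by simp

theorem id : TotalRec fun _ n => n := of_computable Computable.id

theorem const (c : ℕ) : TotalRec fun _ _ => c := of_computable (Computable.const c)

theorem fst {F : Cantor → ℕ → ℕ} (hF : TotalRec F) : TotalRec fun p n => (F p n).unpair.1 :=
  comp (of_computable (Computable.fst.comp Computable.unpair)) hF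

theorem snd {F : Cantor → ℕ → ℕ} (hF : TotalRec F) : TotalRec fun p n => (F p n).unpair.2 :=
  comp (of_computable (Computable.snd.comp Computable.unpair)) hF

theorem succ {F : Cantor → ℕ → ℕ} (hF : TotalRec F) : TotalRec fun p n => F p n + 1 :=
  comp (of_computable Computable.succ) hF

theorem pred {F : Cantor → ℕ → ℕ} (hF : TotalRec F) : TotalRec fun p n => F p n - 1 :=
  comp (of_computable Computable.pred) hF

theorem ite {F G H : Cantor → ℕ → ℕ} (hF : TotalRec F) (hG : TotalRec G) (hH : TotalRec H) :
    TotalRec fun p n => if F p n = 0 then G p n else H p n := by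
  have h : Computable₂ fun a b : ℕ => if a = 0 then b.unpair.1 else b.unpair.2 := by
    refine Primrec.to_comp (f := fun x : ℕ × ℕ =>
      if x.1 = 0 then x.2.unpair.1 else x.2.unpair.2) ?_
    exact Primrec.ite (Primrec.eq.comp Primrec.fst (Primrec.const 0))
      (Primrec.fst.comp (Primrec.unpair.comp Primrec.snd))
      (Primrec.snd.comp (Primrec.unpair.comp Primrec.snd))
  exact (comp₂ h hF (hG.pair hH)).of_eq fun p n => by simp

theorem iteEq {A B G H : Cantor → ℕ → ℕ} (hA : TotalRec A) (hB : TotalRec B) (hG : TotalRec G)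
    (hH : TotalRec H) : TotalRec fun p n => if A p n = B p n then G p n else H p n := by
  have h : Computable₂ fun a b : ℕ => if a = b then 0 else 1 :=
    Primrec.to_comp (f := fun x : ℕ × ℕ => if x.1 = x.2 then 0 else 1)
      (Primrec.ite (Primrec.eq.comp Primrec.fst Primrec.snd) (Primrec.const 0) (Primrec.const 1))
  refine (ite (comp₂ h hA hB) hG hH).of_eq fun p n => ?_
  by_cases e : A p n = B p n <;> simp [e]

theorem prec {F H : Cantor → ℕ → ℕ} (hF : TotalRec F) (hH : TotalRec H) :
    TotalRec fun p m => Nat.rec (F p (Nat.unpair m).1)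
      (fun y i => H p (Nat.pair (Nat.unpair m).1 (Nat.pair y i))) (Nat.unpair m).2 := by
  refine (OracleRec.prec hF hH).of_eq fun p m => ?_
  beta_reduce
  generalize (Nat.unpair m).2 = n
  induction n with
  | zero => rfl
  | succ k ih => simp only [ih, Part.bind_some]

end TotalRec

theorem mem_rfind_iff {f : ℕ →. Bool} {n : ℕ} :
    n ∈ Nat.rfind f ↔ true ∈ f n ∧ ∀ m < n, false ∈ f m :=
  ⟨fun h => ⟨(Nat.mem_rfind.1 h).1, fun _ hm => (Nat.mem_rfind.1 h).2 hm⟩,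
    fun h => Nat.mem_rfind.2 ⟨h.1, fun {m} hm => h.2 m hm⟩⟩

/-- Unbounded search over stages. -/
theorem OracleRec.of_stage {G : Cantor → ℕ → ℕ} (hG : TotalRec G) :
    ∃ T, OracleRec T ∧ ∀ p n v, v ∈ T p n ↔
      ∃ k, G p (Nat.pair n k) = v + 1 ∧ ∀ j < k, G p (Nat.pair n j) = 0 := by
  have h1 := OracleRec.rfind (TotalRec.ite hG (TotalRec.const 1) (TotalRec.const 0))
  have h2 := OracleRec.comp (TotalRec.pred hG) (OracleRec.pair TotalRec.id h1)
  refine ⟨_, h2, fun p n v => ?_⟩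
  simp only [Part.mem_bind_iff, Part.mem_some_iff, Part.bind_some, Part.mem_map_iff,
    Part.map_some]
  constructor
  · rintro ⟨a, ⟨k, hk', rfl⟩, rfl⟩
    obtain ⟨hk, hlt⟩ := mem_rfind_iff.1 hk'
    refine ⟨k, ?_, fun j hj => ?_⟩
    · by_contra h
      have : G p (Nat.pair n k) = 0 := by omega
      simp [this] at hk
    · by_contra h
      have := hlt j hj
      simp [h] at this
  · rintro ⟨k, hk, hlt⟩
    exact ⟨_, ⟨k, mem_rfind_iff.2 ⟨by simp [hk], fun j hj => by simp [hlt j hj]⟩, rfl⟩,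
      by simp [hk]⟩

/-- Computations in stages: `G p ⟨n, k⟩` is `v + 1` if `T^p(n) = v` has been found by stage `k`,
and `0` if nothing has been found. -/
theorem OracleRec.exists_stage {T : Cantor → ℕ →. ℕ} (hT : OracleRec T) :
    ∃ G, TotalRec G ∧
      (∀ p n v, v ∈ T p n ↔ ∃ k, G p (Nat.pair n k) = v + 1) ∧
      (∀ p n v k l, k ≤ l → G p (Nat.pair n k) = v + 1 → G p (Nat.pair n l) = v + 1) := by
  have tot : ∀ F : Cantor → ℕ → ℕ, TotalRec F → ∃ G, TotalRec G ∧
      (∀ p n v, v ∈ Part.some (F p n) ↔ ∃ k, G p (Nat.pair n k) = v + 1) ∧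
      (∀ p n v k l, k ≤ l → G p (Nat.pair n k) = v + 1 → G p (Nat.pair n l) = v + 1) := by
    intro F hF
    refine ⟨fun p m => F p m.unpair.1 + 1, (hF.comp TotalRec.id.fst).succ, ?_, ?_⟩
    · intro p n v
      simp [eq_comm]
    · intro p n v k l _ h
      simpa using h
  induction hT with
  | zero => exact tot _ OracleRec.zero
  | succ => exact tot _ OracleRec.succ
  | left => exact tot _ OracleRec.left
  | right => exact tot _ OracleRec.right
  | oracle => exact tot _ OracleRec.oracle
  | pair _ _ ih1 ih2 =>
    obtain ⟨G, hG, hG1, hG2⟩ := ih1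
    obtain ⟨H, hH, hH1, hH2⟩ := ih2
    refine ⟨fun p m => if G p m = 0 then 0 else if H p m = 0 then 0 else
      Nat.pair (G p m - 1) (H p m - 1) + 1,
      hG.ite (TotalRec.const 0) (hH.ite (TotalRec.const 0) (hG.pred.pair hH.pred).succ), ?_, ?_⟩
    · intro p n v
      simp only [Part.mem_bind_iff, Part.mem_map_iff]
      constructor
      · rintro ⟨a, ha, b, hb, rfl⟩
        obtain ⟨k, hk⟩ := (hG1 p n a).1 ha
        obtain ⟨l, hl⟩ := (hH1 p n b).1 hb
        refine ⟨max k l, ?_⟩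
        simp [hG2 p n a k _ (le_max_left k l) hk, hH2 p n b l _ (le_max_right k l) hl]
      · rintro ⟨k, hk⟩
        split_ifs at hk with h1 h2
        refine ⟨G p (Nat.pair n k) - 1, (hG1 _ _ _).2 ⟨k, by omega⟩,
          H p (Nat.pair n k) - 1, (hH1 _ _ _).2 ⟨k, by omega⟩, by omega⟩
    · intro p n v k l hkl hk
      beta_reduce at hk ⊢
      split_ifs at hk with h1 h2
      have e1 := hG2 p n (G p (Nat.pair n k) - 1) k l hkl (by omega)
      have e2 := hH2 p n (H p (Nat.pair n k) - 1) k l hkl (by omega)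
      simp only [e1, e2]
      simpa using hk
  | comp _ _ ih1 ih2 =>
    obtain ⟨G, hG, hG1, hG2⟩ := ih1
    obtain ⟨H, hH, hH1, hH2⟩ := ih2
    refine ⟨fun p m => if H p m = 0 then 0 else G p (Nat.pair (H p m - 1) m.unpair.2),
      hH.ite (TotalRec.const 0) (hG.comp (hH.pred.pair TotalRec.id.snd)), ?_, ?_⟩
    · intro p n v
      simp only [Part.mem_bind_iff]
      constructor
      · rintro ⟨a, ha, hv⟩
        obtain ⟨k, hk⟩ := (hH1 p n a).1 ha
        obtain ⟨l, hl⟩ := (hG1 p a v).1 hv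
        refine ⟨max k l, ?_⟩
        simp [hH2 p n a k _ (le_max_left k l) hk, hG2 p a v l _ (le_max_right k l) hl]
      · rintro ⟨k, hk⟩
        split_ifs at hk with h1
        refine ⟨H p (Nat.pair n k) - 1, (hH1 _ _ _).2 ⟨k, by omega⟩,
          (hG1 _ _ _).2 ⟨k, by simpa using hk⟩⟩
    · intro p n v k l hkl hk
      beta_reduce at hk ⊢
      split_ifs at hk with h1
      have e1 := hH2 p n (H p (Nat.pair n k) - 1) k l hkl (by omega)
      have e2 := hG2 p (H p (Nat.pair n k) - 1) v k l hkl (by simpa using hk)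
      simp only [e1]
      simpa using e2
  | @prec f h _ _ ih1 ih2 =>
    obtain ⟨G, hG, hG1, hG2⟩ := ih1
    obtain ⟨H, hH, hH1, hH2⟩ := ih2
    obtain ⟨R, hR0, hR1, hR⟩ : ∃ R : Cantor → ℕ → ℕ → ℕ → ℕ,
        (∀ p a k, R p a k 0 = G p (Nat.pair a k)) ∧
        (∀ p a k y, R p a k (y + 1) = if R p a k y = 0 then 0 else
          H p (Nat.pair (Nat.pair a (Nat.pair y (R p a k y - 1))) k)) ∧
        TotalRec fun p m => R p m.unpair.1.unpair.1 m.unpair.2 m.unpair.1.unpair.2 := by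
      refine ⟨fun p a k n => Nat.rec (G p (Nat.pair a k)) (fun y i => if i = 0 then 0 else
        H p (Nat.pair (Nat.pair a (Nat.pair y (i - 1))) k)) n, fun _ _ _ => rfl,
        fun _ _ _ _ => rfl, ?_⟩
      have s : TotalRec fun p m => if m.unpair.2.unpair.2 = 0 then 0 else
          H p (Nat.pair (Nat.pair m.unpair.1.unpair.1 (Nat.pair m.unpair.2.unpair.1
            (m.unpair.2.unpair.2 - 1))) m.unpair.1.unpair.2) :=
        TotalRec.id.snd.snd.ite (TotalRec.const 0) (hH.comp
          ((TotalRec.id.fst.fst.pair (TotalRec.id.snd.fst.pair TotalRec.id.snd.snd.pred)).pair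
            TotalRec.id.fst.snd))
      refine ((TotalRec.prec hG s).comp ((TotalRec.id.fst.fst.pair TotalRec.id.snd).pair
        TotalRec.id.fst.snd)).of_eq fun p m => ?_
      simp
    have mono : ∀ p a n v k l, k ≤ l → R p a k n = v + 1 → R p a l n = v + 1 := by
      intro p a n v k l hkl
      induction n generalizing v with
      | zero => simpa only [hR0] using hG2 p a v k l hkl
      | succ y ih =>
        intro hk
        rw [hR1] at hk
        split_ifs at hk with h1
        have e1 := ih (R p a k y - 1) (by omega)
        rw [hR1, e1]
        simpa using hH2 p _ v k l hkl hk
    refine ⟨_, hR, ?_, ?_⟩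
    · intro p m v
      simp only [Nat.unpair_pair]
      generalize (Nat.unpair m).1 = a
      generalize (Nat.unpair m).2 = n
      induction n generalizing v with
      | zero => simp only [hR0]; exact hG1 p a v
      | succ y ih =>
        simp only [Part.mem_bind_iff]
        constructor
        · rintro ⟨i, hi, hv⟩
          obtain ⟨k, hk⟩ := (ih i).1 hi
          obtain ⟨l, hl⟩ := (hH1 p _ v).1 hv
          refine ⟨max k l, ?_⟩
          rw [hR1, mono p a y i k _ (le_max_left k l) hk]
          simpa using hH2 p _ v l _ (le_max_right k l) hl
        · rintro ⟨k, hk⟩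
          rw [hR1] at hk
          split_ifs at hk with h1
          exact ⟨R p a k y - 1, (ih _).2 ⟨k, by omega⟩, (hH1 _ _ _).2 ⟨k, hk⟩⟩
    · intro p m v k l hkl hk
      simp only [Nat.unpair_pair] at hk ⊢
      exact mono _ _ _ _ _ _ hkl hk
  | @rfind f _ ih =>
    obtain ⟨G, hG, hG1, hG2⟩ := ih
    -- `0`: still searching; `1`: stuck; `v + 2`: the least zero `v` has been found
    obtain ⟨R, hR0, hR1, hR⟩ : ∃ R : Cantor → ℕ → ℕ → ℕ → ℕ, (∀ p a k, R p a k 0 = 0) ∧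
        (∀ p a k y, R p a k (y + 1) = if R p a k y = 0 then
          (if G p (Nat.pair (Nat.pair a y) k) = 0 then 1 else
            if G p (Nat.pair (Nat.pair a y) k) = 1 then y + 2 else 0) else R p a k y) ∧
        TotalRec fun p m => R p m.unpair.1 m.unpair.2 m.unpair.2 := by
      refine ⟨fun p a k n => Nat.rec 0 (fun y i => if i = 0 then
        (if G p (Nat.pair (Nat.pair a y) k) = 0 then 1 else
          if G p (Nat.pair (Nat.pair a y) k) = 1 then y + 2 else 0) else i) n, fun _ _ _ => rfl,
        fun _ _ _ _ => rfl, ?_⟩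
      have g : TotalRec fun p m => G p (Nat.pair (Nat.pair m.unpair.1.unpair.1
          m.unpair.2.unpair.1) m.unpair.1.unpair.2) :=
        hG.comp ((TotalRec.id.fst.fst.pair TotalRec.id.snd.fst).pair TotalRec.id.fst.snd)
      have s := TotalRec.id.snd.snd.ite (g.ite (TotalRec.const 1)
        (g.iteEq (TotalRec.const 1) TotalRec.id.snd.fst.succ.succ (TotalRec.const 0)))
        TotalRec.id.snd.snd
      refine ((TotalRec.prec (TotalRec.const 0) s).comp ((TotalRec.id.fst.pair
        TotalRec.id.snd).pair TotalRec.id.snd)).of_eq fun p m => ?_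
      simp
    have zero_iff : ∀ p a k n, R p a k n = 0 ↔ ∀ y < n, 2 ≤ G p (Nat.pair (Nat.pair a y) k) := by
      intro p a k n
      induction n with
      | zero => simp [hR0]
      | succ y ih =>
        rw [hR1]
        constructor
        · intro h z hz
          split_ifs at h with h1 h2 h3
          · rcases Nat.lt_succ_iff_lt_or_eq.1 hz with h4 | rfl
            · exact ih.1 h1 z h4
            · omega
          · exact absurd h h1
        · intro h
          have h1 := ih.2 fun z hz => h z (by omega)
          have h2 := h y (by omega)
          rw [if_pos h1, if_neg (by omega), if_neg (by omega)]
    have found_iff : ∀ p a k n v, R p a k n = v + 2 ↔ v < n ∧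
        G p (Nat.pair (Nat.pair a v) k) = 1 ∧
        ∀ y < v, 2 ≤ G p (Nat.pair (Nat.pair a y) k) := by
      intro p a k n v
      induction n with
      | zero => simp [hR0]
      | succ y ih =>
        rw [hR1]
        split_ifs with h1 h2 h3
        · have := (zero_iff p a k y).1 h1
          refine ⟨fun h => by omega, fun ⟨h4, h5, h6⟩ => ?_⟩
          rcases Nat.lt_succ_iff_lt_or_eq.1 h4 with h7 | rfl
          · have := this v h7; omega
          · omega
        · have := (zero_iff p a k y).1 h1
          constructor
          · intro h
            obtain rfl : v = y := by omega
            exact ⟨by omega, h3, this⟩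
          · rintro ⟨h4, h5, h6⟩
            rcases Nat.lt_succ_iff_lt_or_eq.1 h4 with h7 | rfl
            · have := this v h7; omega
            · rfl
        · have := (zero_iff p a k y).1 h1
          refine ⟨fun h => h.elim, fun ⟨h4, h5, h6⟩ => ?_⟩
          rcases Nat.lt_succ_iff_lt_or_eq.1 h4 with h7 | rfl
          · have := this v h7; omega
          · omega
        · rw [ih]
          refine ⟨fun ⟨h4, h5⟩ => ⟨by omega, h5⟩, fun ⟨h4, h5, h6⟩ => ⟨?_, h5, h6⟩⟩
          by_contra h7
          obtain rfl : v = y := by omega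
          exact h1 ((zero_iff p a k v).2 h6)
    have stage_mono : ∀ p a k l v, k ≤ l → G p (Nat.pair (Nat.pair a v) k) = 1 →
        G p (Nat.pair (Nat.pair a v) l) = 1 := fun p a k l v hkl h => hG2 p _ 0 k l hkl h
    have stage_mono' : ∀ p a k l v, k ≤ l → 2 ≤ G p (Nat.pair (Nat.pair a v) k) →
        2 ≤ G p (Nat.pair (Nat.pair a v) l) := fun p a k l v hkl h => by
      have := hG2 p (Nat.pair a v) (G p (Nat.pair (Nat.pair a v) k) - 1) k l hkl (by omega)
      omega
    refine ⟨_, hR.pred, ?_, ?_⟩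
    · intro p a v
      simp only [Nat.unpair_pair]
      refine mem_rfind_iff.trans ?_
      simp only [Part.mem_map_iff]
      have e : ∀ k, R p a k k - 1 = v + 1 ↔ R p a k k = v + 2 := fun k => by omega
      simp only [e, found_iff]
      constructor
      · rintro ⟨⟨m, hm, hm0⟩, hlt⟩
        obtain rfl : m = 0 := by simpa using hm0
        obtain ⟨k, hk⟩ := (hG1 _ _ _).1 hm
        have hlt' : ∀ y < v, ∃ k, 2 ≤ G p (Nat.pair (Nat.pair a y) k) := by
          intro y hy
          obtain ⟨m, hm, hm0⟩ := hlt y hy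
          obtain ⟨k, hk⟩ := (hG1 _ _ _).1 hm
          have : m ≠ 0 := by simpa using hm0
          exact ⟨k, by omega⟩
        choose! K hK using hlt'
        refine ⟨k + v + 1 + (Finset.range v).sup K, by omega,
          stage_mono p a k _ v (by omega) hk, fun y hy => ?_⟩
        have : K y ≤ (Finset.range v).sup K := Finset.le_sup (Finset.mem_range.2 hy)
        exact stage_mono' p a (K y) _ y (by omega) (hK y hy)
      · rintro ⟨k, -, hk, hlt⟩
        refine ⟨⟨0, (hG1 _ _ _).2 ⟨k, hk⟩, by simp⟩, fun y hy => ?_⟩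
        have := hlt y hy
        exact ⟨G p (Nat.pair (Nat.pair a y) k) - 1, (hG1 _ _ _).2 ⟨k, by omega⟩,
          by simp; omega⟩
    · intro p a v k l hkl
      simp only [Nat.unpair_pair]
      have e : ∀ k, R p a k k - 1 = v + 1 ↔ R p a k k = v + 2 := fun k => by omega
      simp only [e, found_iff]
      rintro ⟨h1, h2, h3⟩
      exact ⟨by omega, stage_mono p a k l v hkl h2,
        fun y hy => stage_mono' p a k l y hkl (h3 y hy)⟩

theorem OracleRec.of_stage_unique {G : Cantor → ℕ → ℕ} (hG : TotalRec G) :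
    ∃ T, OracleRec T ∧ ∀ p n,
      (∀ v w k l, G p (Nat.pair n k) = v + 1 → G p (Nat.pair n l) = w + 1 → v = w) →
      ∀ v, v ∈ T p n ↔ ∃ k, G p (Nat.pair n k) = v + 1 := by
  obtain ⟨T, hT, h⟩ := OracleRec.of_stage hG
  refine ⟨T, hT, fun p n hu v => (h p n v).trans ⟨fun ⟨k, hk, _⟩ => ⟨k, hk⟩, ?_⟩⟩
  rintro ⟨k, hk⟩
  classical
  have hex : ∃ k, G p (Nat.pair n k) ≠ 0 := ⟨k, by omega⟩
  have hs := Nat.find_spec hex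
  refine ⟨Nat.find hex, ?_, fun j hj => not_not.1 (Nat.find_min hex hj)⟩
  have := hu v (G p (Nat.pair n (Nat.find hex)) - 1) k (Nat.find hex) hk (by omega)
  omega

theorem OracleRec.cond {c : Cantor → ℕ → ℕ} (hc : TotalRec c) {S T : Cantor → ℕ →. ℕ}
    (hS : OracleRec S) (hT : OracleRec T) : ∃ R, OracleRec R ∧
      (∀ p n, c p n = 0 → R p n = S p n) ∧ (∀ p n, c p n ≠ 0 → R p n = T p n) := by
  obtain ⟨G, hG, hG1, hG2⟩ := hS.exists_stage
  obtain ⟨H, hH, hH1, hH2⟩ := hT.exists_stage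
  obtain ⟨R, hR, hR1⟩ := OracleRec.of_stage_unique ((hc.comp TotalRec.id.fst).ite hG hH)
  refine ⟨R, hR, fun p n h => ?_, fun p n h => ?_⟩
  · ext v
    rw [hR1 p n, hG1 p n v]
    · simp [h]
    · intro v w k l hv hw
      simp only [Nat.unpair_pair, h, if_true] at hv hw
      exact Part.mem_unique ((hG1 _ _ _).2 ⟨k, hv⟩) ((hG1 _ _ _).2 ⟨l, hw⟩)
  · ext v
    rw [hR1 p n, hH1 p n v]
    · simp [h]
    · intro v w k l hv hw
      simp only [Nat.unpair_pair, h, if_false] at hv hw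
      exact Part.mem_unique ((hH1 _ _ _).2 ⟨k, hv⟩) ((hH1 _ _ _).2 ⟨l, hw⟩)

/-- The oracle program `T` computes the point `q` from the oracle `p`. -/
def Computes (T : Cantor → ℕ →. ℕ) (p q : Cantor) : Prop := ∀ n, (q n).toNat ∈ T p n

theorem Computes.eq {T : Cantor → ℕ →. ℕ} {p q r : Cantor} (hq : Computes T p q)
    (hr : Computes T p r) : q = r := by
  funext n
  have := Part.mem_unique (hq n) (hr n)
  revert this
  cases q n <;> cases r n <;> simp

theorem OracleRec.exists_functional {T : Cantor → ℕ →. ℕ} (hT : OracleRec T) :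
    ∃ F, IsTuringFunctional F ∧ ∀ p q, q ∈ F p ↔ Computes T p q := by
  have h : ∀ p q, q ∈ (⟨∃ q, Computes T p q, fun h => h.choose⟩ : Part Cantor) ↔
      Computes T p q := fun p q =>
    ⟨fun ⟨h, e⟩ => e ▸ h.choose_spec, fun h => ⟨⟨q, h⟩, (Exists.choose_spec ⟨q, h⟩).eq h⟩⟩
  exact ⟨_, ⟨T, hT, h⟩, h⟩

/-- Substitution of the output of a program as the oracle of another one. -/
theorem OracleRec.subst {S T : Cantor → ℕ →. ℕ} (hS : OracleRec S) (hT : OracleRec T) :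
    ∃ R, OracleRec R ∧ ∀ p q, Computes T p q → R p = S q := by
  induction hS with
  | zero => exact ⟨_, OracleRec.zero, fun _ _ _ => rfl⟩
  | succ => exact ⟨_, OracleRec.succ, fun _ _ _ => rfl⟩
  | left => exact ⟨_, OracleRec.left, fun _ _ _ => rfl⟩
  | right => exact ⟨_, OracleRec.right, fun _ _ _ => rfl⟩
  | oracle => exact ⟨T, hT, fun p q h => funext fun n => Part.eq_some_iff.2 (h n)⟩
  | pair _ _ ih1 ih2 =>
    obtain ⟨R1, h1, e1⟩ := ih1
    obtain ⟨R2, h2, e2⟩ := ih2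
    exact ⟨_, OracleRec.pair h1 h2, fun p q h => by rw [e1 p q h, e2 p q h]⟩
  | comp _ _ ih1 ih2 =>
    obtain ⟨R1, h1, e1⟩ := ih1
    obtain ⟨R2, h2, e2⟩ := ih2
    exact ⟨_, OracleRec.comp h1 h2, fun p q h => by rw [e1 p q h, e2 p q h]⟩
  | prec _ _ ih1 ih2 =>
    obtain ⟨R1, h1, e1⟩ := ih1
    obtain ⟨R2, h2, e2⟩ := ih2
    exact ⟨_, OracleRec.prec h1 h2, fun p q h => by rw [e1 p q h, e2 p q h]⟩
  | rfind _ ih =>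
    obtain ⟨R, h, e⟩ := ih
    exact ⟨_, OracleRec.rfind h, fun p q h => by rw [e p q h]⟩

theorem OracleRec.exists_comp {S T : Cantor → ℕ →. ℕ} (hS : OracleRec S) (hT : OracleRec T) :
    ∃ R, OracleRec R ∧ ∀ p q r, Computes T p q → Computes S q r → Computes R p r := by
  obtain ⟨R, hR, h⟩ := hS.subst hT
  refine ⟨R, hR, fun p q r hq hr n => ?_⟩
  rw [h p q hq]
  exact hr n

theorem TotalRec.computes {F : Cantor → ℕ → ℕ} {p q : Cantor}
    (h : ∀ n, F p n = (q n).toNat) : Computes (fun p n => Part.some (F p n)) p q :=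
  fun n => Part.mem_some_iff.2 (h n).symm

theorem exists_id : ∃ T, OracleRec T ∧ ∀ p, Computes T p p :=
  ⟨_, OracleRec.oracle, fun _ => TotalRec.computes fun _ => rfl⟩

theorem cjoin_two_mul (p q : Cantor) (n : ℕ) : cjoin p q (2 * n) = p n := by
  simp [cjoin]

theorem cjoin_two_mul_add_one (p q : Cantor) (n : ℕ) : cjoin p q (2 * n + 1) = q n := by
  have h1 : (2 * n + 1) % 2 = 1 := by omega
  have h2 : (2 * n + 1) / 2 = n := by omega
  simp [cjoin, h1, h2]

theorem cjoin_inj {p q p' q' : Cantor} (h : cjoin p q = cjoin p' q') : p = p' ∧ q = q' := by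
  constructor
  · funext n
    rw [← cjoin_two_mul p q, h, cjoin_two_mul]
  · funext n
    rw [← cjoin_two_mul_add_one p q, h, cjoin_two_mul_add_one]

theorem tag_ne : tag 0 ≠ tag 1 := fun h => by
  have := congrFun h 0
  simp [tag] at this

theorem exists_fst : ∃ T, OracleRec T ∧ ∀ a b, Computes T (cjoin a b) a := by
  have h : Computable fun n : ℕ => 2 * n :=
    (Primrec.nat_mul.comp (Primrec.const 2) Primrec.id).to_comp
  exact ⟨_, TotalRec.oracle.comp (TotalRec.of_computable h), fun a b =>
    TotalRec.computes fun n => by rw [cjoin_two_mul]⟩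

theorem exists_snd : ∃ T, OracleRec T ∧ ∀ a b, Computes T (cjoin a b) b := by
  have h : Computable fun n : ℕ => 2 * n + 1 :=
    (Primrec.succ.comp (Primrec.nat_mul.comp (Primrec.const 2) Primrec.id)).to_comp
  exact ⟨_, TotalRec.oracle.comp (TotalRec.of_computable h), fun a b =>
    TotalRec.computes fun n => by rw [cjoin_two_mul_add_one]⟩

theorem exists_tag (i : ℕ) : ∃ T, OracleRec T ∧ ∀ p, Computes T p (tag i) := by
  refine ⟨_, TotalRec.id.iteEq (TotalRec.const i) (TotalRec.const 1) (TotalRec.const 0),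
    fun p => TotalRec.computes fun n => ?_⟩
  by_cases h : n = i <;> simp [tag, h]

theorem exists_cjoin {S T : Cantor → ℕ →. ℕ} (hS : OracleRec S) (hT : OracleRec T) :
    ∃ R, OracleRec R ∧ ∀ p a b, Computes S p a → Computes T p b → Computes R p (cjoin a b) := by
  have h2 : TotalRec fun _ n => n / 2 :=
    TotalRec.of_computable (Primrec.nat_div.comp Primrec.id (Primrec.const 2)).to_comp
  have h3 : TotalRec fun _ n => n % 2 :=
    TotalRec.of_computable (Primrec.nat_mod.comp Primrec.id (Primrec.const 2)).to_comp
  obtain ⟨R, hR, h0, h1⟩ := OracleRec.cond h3 (OracleRec.comp hS h2) (OracleRec.comp hT h2)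
  refine ⟨R, hR, fun p a b ha hb n => ?_⟩
  by_cases h : n % 2 = 0
  · rw [h0 p n h]
    simpa [cjoin, h] using ha (n / 2)
  · rw [h1 p n h]
    simpa [cjoin, h] using hb (n / 2)

theorem exists_addTag (i : ℕ) : ∃ T, OracleRec T ∧ ∀ p, Computes T p (cjoin (tag i) p) := by
  obtain ⟨S, hS, h1⟩ := exists_tag i
  obtain ⟨T, hT, h2⟩ := exists_id
  obtain ⟨R, hR, h3⟩ := exists_cjoin hS hT
  exact ⟨R, hR, fun p => h3 _ _ _ (h1 p) (h2 p)⟩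

/-- Case distinction on the tag of the oracle. -/
theorem exists_cases {S T : Cantor → ℕ →. ℕ} (hS : OracleRec S) (hT : OracleRec T) :
    ∃ R, OracleRec R ∧
      (∀ p q, Computes S p q → Computes R (cjoin (tag 0) p) q) ∧
      (∀ p q, Computes T p q → Computes R (cjoin (tag 1) p) q) := by
  obtain ⟨P, hP, hP1⟩ := exists_snd
  obtain ⟨S', hS', hS1⟩ := hS.exists_comp hP
  obtain ⟨T', hT', hT1⟩ := hT.exists_comp hP
  obtain ⟨R, hR, h0, h1⟩ := OracleRec.cond (TotalRec.oracle.comp (TotalRec.const 0)) hT' hS'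
  refine ⟨R, hR, fun p q h n => ?_, fun p q h n => ?_⟩
  · rw [h1 _ n (by simp [cjoin, tag])]
    exact hS1 _ _ _ (hP1 _ _) h n
  · rw [h0 _ n (by simp [cjoin, tag])]
    exact hT1 _ _ _ (hP1 _ _) h n

theorem triple_inj {n s i n' s' i' : ℕ} (h : triple n s i = triple n' s' i') :
    n = n' ∧ s = s' ∧ i = i' := by
  simpa [triple, Nat.pair_eq_pair] using h

open Classical in
theorem mem_approxEval {a y : Cantor} : y ∈ approxEval a ↔
    IsMonotoneApprox a ∧ ∀ n, ∃ s, a (triple n s (y n).toNat) = true := by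
  constructor
  · rintro ⟨⟨hm, ht⟩, rfl⟩
    refine ⟨hm, fun n => ?_⟩
    obtain ⟨s, i, hi, h⟩ := ht n
    refine ⟨s, ?_⟩
    simp only [approxEval]
    by_cases h1 : ∃ s, a (triple n s 1) = true
    · obtain ⟨t, h2⟩ := h1
      obtain ⟨rfl, rfl⟩ := hm.unique n s t i 1 hi (by omega) h h2
      rw [decide_eq_true ⟨s, h⟩]
      exact h
    · have : i ≠ 1 := by
        rintro rfl
        exact h1 ⟨s, h⟩
      obtain rfl : i = 0 := by omega
      rw [decide_eq_false h1]
      exact h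
  · rintro ⟨hm, ht⟩
    refine ⟨⟨hm, fun n => ?_⟩, ?_⟩
    · obtain ⟨s, h⟩ := ht n
      exact ⟨s, _, Bool.toNat_lt _, h⟩
    · funext n
      obtain ⟨s, h⟩ := ht n
      simp only [approxEval]
      cases hy : y n with
      | true =>
        rw [hy] at h
        exact decide_eq_true ⟨s, h⟩
      | false =>
        rw [hy] at h
        refine decide_eq_false ?_
        rintro ⟨t, h2⟩
        have := (hm.unique n s t 0 1 (by omega) (by omega) h h2).2
        omega

theorem exists_eval : ∃ T, OracleRec T ∧ ∀ a y, y ∈ approxEval a → Computes T a y := by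
  have look : ∀ i, TotalRec fun p m => (p (triple m.unpair.1 m.unpair.2 i)).toNat := fun i =>
    TotalRec.oracle.comp (TotalRec.id.fst.pair (TotalRec.id.snd.pair (TotalRec.const i)))
  obtain ⟨T, hT, h⟩ := OracleRec.of_stage_unique
    (((look 0).iteEq (TotalRec.const 1) (TotalRec.const 1)
      ((look 1).iteEq (TotalRec.const 1) (TotalRec.const 2) (TotalRec.const 0))))
  refine ⟨T, hT, fun a y hy n => ?_⟩
  obtain ⟨hm, ht⟩ := mem_approxEval.1 hy
  simp only [Nat.unpair_pair, Bool.toNat_eq_one] at h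
  obtain ⟨s, hs⟩ := ht n
  have key : ∀ k v, ((if a (triple n k 0) = true then 1 else
      if a (triple n k 1) = true then 2 else 0) = v + 1) → v = (y n).toNat := by
    intro k v hv
    split_ifs at hv with h1 h2
    · have := (hm.unique n s k _ 0 (Bool.toNat_lt _) (by omega) hs h1).2
      omega
    · have := (hm.unique n s k _ 1 (Bool.toNat_lt _) (by omega) hs h2).2
      omega
  refine (h a n (fun v w k l hv hw => (key k v hv).trans (key l w hw).symm) _).2 ⟨s, ?_⟩
  cases hyn : y n with
  | true =>
    rw [hyn] at hs
    have h0 : ¬ a (triple n s 0) = true := fun h0 => by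
      have := (hm.unique n s s 1 0 (by omega) (by omega) hs h0).2
      omega
    exact (if_neg h0).trans (if_pos hs)
  | false =>
    rw [hyn] at hs
    exact if_pos hs

/-- The monotone approximation that is produced by a computation. -/
theorem exists_approx {T : Cantor → ℕ →. ℕ} (hT : OracleRec T) :
    ∃ A, OracleRec A ∧ ∀ q, ∃ a, Computes A q a ∧ ∀ r, Computes T q r → r ∈ approxEval a := by
  obtain ⟨G, hG, hG1, hG2⟩ := hT.exists_stage
  obtain ⟨L, hL0, hL1, hL⟩ : ∃ L : Cantor → ℕ → ℕ, (∀ q, L q 0 = 0) ∧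
      (∀ q s, L q (s + 1) = if G q (Nat.pair (L q s) s) = 1 then L q s + 1 else
        if G q (Nat.pair (L q s) s) = 2 then L q s + 1 else L q s) ∧ TotalRec L := by
    refine ⟨fun q s => Nat.rec 0 (fun s l => if G q (Nat.pair l s) = 1 then l + 1 else
        if G q (Nat.pair l s) = 2 then l + 1 else l) s, fun _ => rfl, fun _ _ => rfl, ?_⟩
    have g := hG.comp (TotalRec.id.snd.snd.pair TotalRec.id.snd.fst)
    have st := g.iteEq (TotalRec.const 1) TotalRec.id.snd.snd.succ
      (g.iteEq (TotalRec.const 2) TotalRec.id.snd.snd.succ TotalRec.id.snd.snd)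
    exact ((TotalRec.prec (TotalRec.const 0) st).comp
      ((TotalRec.const 0).pair TotalRec.id)).of_eq fun p m => by simp
  have hLle : ∀ q s, L q s ≤ L q (s + 1) := fun q s => by
    rw [hL1]; split_ifs <;> omega
  have hLmono : ∀ q, Monotone (L q) := fun q => monotone_nat_of_le_succ (hLle q)
  have i := TotalRec.id.snd.snd
  have hA := (hL.comp TotalRec.id.snd.fst).iteEq TotalRec.id.fst
    ((hG.comp (TotalRec.id.fst.pair TotalRec.id.snd.fst)).iteEq i.succ
      (i.ite (TotalRec.const 1) (i.iteEq (TotalRec.const 1) (TotalRec.const 1)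
        (TotalRec.const 0))) (TotalRec.const 0)) (TotalRec.const 0)
  refine ⟨_, hA, fun q => ?_⟩
  let a : Cantor := fun m => decide (L q m.unpair.2.unpair.1 = m.unpair.1 ∧
    G q (Nat.pair m.unpair.1 m.unpair.2.unpair.1) = m.unpair.2.unpair.2 + 1 ∧
    m.unpair.2.unpair.2 < 2)
  have ha : ∀ n s i, a (triple n s i) = true ↔
      L q s = n ∧ G q (Nat.pair n s) = i + 1 ∧ i < 2 := by
    intro n s i
    simp [a, triple]
  refine ⟨a, TotalRec.computes fun m => ?_, fun r hr => ?_⟩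
  · by_cases h1 : L q m.unpair.2.unpair.1 = m.unpair.1
    · by_cases h2 : G q (Nat.pair m.unpair.1 m.unpair.2.unpair.1) = m.unpair.2.unpair.2 + 1
      · by_cases h3 : m.unpair.2.unpair.2 = 0
        · simp [a, h1, h2, h3]
        · by_cases h4 : m.unpair.2.unpair.2 = 1
          · simp [a, h1, h2, h4]
          · have h5 : ¬ m.unpair.2.unpair.2 ≤ 1 := by omega
            simp [a, h1, h2, h3, h4, h5]
      · simp [a, h1, h2]
    · simp [a, h1]
  · have hstep : ∀ n s i, a (triple n s i) = true → L q (s + 1) = n + 1 := by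
      intro n s i h
      obtain ⟨rfl, h2, h3⟩ := (ha n s i).1 h
      rw [hL1]
      split_ifs <;> omega
    have hval : ∀ n s i, G q (Nat.pair n s) = i + 1 → i = (r n).toNat := fun n s i h =>
      Part.mem_unique ((hG1 q n i).2 ⟨s, h⟩) (hr n)
    have hfind : ∀ n, (∃ s, L q s = n) → ∃ s, a (triple n s (r n).toNat) = true := by
      rintro n ⟨s₀, hs₀⟩
      have hlt : (r n).toNat < 2 := Bool.toNat_lt _
      by_contra hno
      push Not at hno
      have hstay : ∀ d, L q (s₀ + d) = n := by
        intro d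
        induction d with
        | zero => exact hs₀
        | succ d ih =>
          have hne : G q (Nat.pair n (s₀ + d)) ≠ (r n).toNat + 1 := fun h =>
            hno (s₀ + d) ((ha _ _ _).2 ⟨ih, h, hlt⟩)
          rw [← add_assoc, hL1, ih]
          split_ifs with h1 h2
          · have := hval n (s₀ + d) 0 h1; omega
          · have := hval n (s₀ + d) 1 h2; omega
          · rfl
      obtain ⟨k, hk⟩ := (hG1 q n _).1 (hr n)
      exact hno (s₀ + k) ((ha _ _ _).2 ⟨hstay k, hG2 q n _ k _ (by omega) hk, hlt⟩)
    have hreach : ∀ n, ∃ s, L q s = n := by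
      intro n
      induction n with
      | zero => exact ⟨0, hL0 q⟩
      | succ n ih =>
        obtain ⟨s, hs⟩ := hfind n ih
        exact ⟨s + 1, hstep _ _ _ hs⟩
    refine mem_approxEval.2 ⟨⟨?_, ?_, ?_⟩, fun n => hfind n (hreach n)⟩
    · intro m hm
      have e : m = triple m.unpair.1 m.unpair.2.unpair.1 m.unpair.2.unpair.2 := by
        simp [triple]
      rw [e] at hm
      exact ⟨_, _, _, ((ha _ _ _).1 hm).2.2, e⟩
    · intro n s t i j _ _ h1 h2
      obtain ⟨hs, hsi, -⟩ := (ha _ _ _).1 h1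
      obtain ⟨ht, htj, -⟩ := (ha _ _ _).1 h2
      have hs' := hstep _ _ _ h1
      have ht' := hstep _ _ _ h2
      obtain rfl : s = t := by
        rcases lt_trichotomy s t with h | h | h
        · have := hLmono q (Nat.succ_le_of_lt h)
          simp only [Nat.succ_eq_add_one] at this
          omega
        · exact h
        · have := hLmono q (Nat.succ_le_of_lt h)
          simp only [Nat.succ_eq_add_one] at this
          omega
      exact ⟨rfl, by omega⟩
    · intro m n s t i j _ _ h1 h2 hmn
      obtain ⟨hs, -, -⟩ := (ha _ _ _).1 h1
      obtain ⟨ht, -, -⟩ := (ha _ _ _).1 h2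
      by_contra h
      have := hLmono q (not_lt.1 h)
      omega

/-! ## The lattice of strong Weihrauch degrees -/

namespace Problem

theorem mem_comp_comp {Φ G Ψ : Cantor →. Cantor} {p r : Cantor} :
    r ∈ Ψ.comp (G.comp Φ) p ↔ ∃ p' ∈ Φ p, ∃ q ∈ G p', r ∈ Ψ q := by
  rw [PFun.comp_apply]
  refine Part.mem_bind_iff.trans ⟨?_, ?_⟩
  · rintro ⟨q, hq, hr⟩
    rw [PFun.comp_apply] at hq
    obtain ⟨p', hp', hq⟩ := Part.mem_bind_iff.1 hq
    exact ⟨p', hp', q, hq, hr⟩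
  · rintro ⟨p', hp', q, hq, hr⟩
    refine ⟨q, ?_, hr⟩
    rw [PFun.comp_apply]
    exact Part.mem_bind_iff.2 ⟨p', hp', hq⟩

/-- Strong Weihrauch reducibility without mention of realizers. -/
theorem sWReducible_iff {f g : Problem} : SWReducible f g ↔
    ∃ S T, OracleRec S ∧ OracleRec T ∧ ∀ p ∈ f.dom, ∃ p' ∈ g.dom, Computes S p p' ∧
      ∀ q ∈ g.sol p', ∃ r ∈ f.sol p, Computes T q r := by
  constructor
  · rintro ⟨Φ, Ψ, ⟨S, hS, hΦ⟩, ⟨T, hT, hΨ⟩, h⟩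
    refine ⟨S, T, hS, hT, fun p hp => ?_⟩
    classical
    -- a realizer of `g` that is defined on `dom g` only and has a prescribed value at `p'`
    have real : ∀ p' q, (p' ∈ g.dom → q ∈ g.sol p') → ∃ G : Cantor →. Cantor, Realizes G g ∧
        (∀ x y, y ∈ G x → x ∈ g.dom) ∧ ∀ y ∈ G p', y = q := by
      intro p' q hq
      refine ⟨fun x => ⟨x ∈ g.dom, fun hx => if x = p' then q else hx.choose⟩, ?_, ?_, ?_⟩
      · intro x hx
        refine ⟨_, ⟨hx, rfl⟩, ?_⟩
        by_cases e : x = p'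
        · subst e
          simpa using hq hx
        · simp only [e, if_false]
          exact hx.choose_spec
      · rintro x y ⟨hx, -⟩
        exact hx
      · rintro y ⟨hx, rfl⟩
        simp
    obtain ⟨G, hG, hG1, -⟩ := real (fun _ => false) (Classical.epsilon fun q =>
      q ∈ g.sol fun _ => false) fun h => Classical.epsilon_spec h
    obtain ⟨r, hr, -⟩ := h G hG p hp
    obtain ⟨p', hp', q, hq, -⟩ := mem_comp_comp.1 hr
    refine ⟨p', hG1 _ _ hq, (hΦ _ _).1 hp', fun q hq => ?_⟩
    obtain ⟨G, hG, -, hG2⟩ := real p' q fun _ => hq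
    obtain ⟨r, hr, hrf⟩ := h G hG p hp
    obtain ⟨p'', hp'', q', hq', hr⟩ := mem_comp_comp.1 hr
    obtain rfl := Part.mem_unique hp' hp''
    obtain rfl := hG2 q' hq'
    exact ⟨r, hrf, (hΨ _ _).1 hr⟩
  · rintro ⟨S, T, hS, hT, h⟩
    obtain ⟨Φ, hΦ, hΦ1⟩ := hS.exists_functional
    obtain ⟨Ψ, hΨ, hΨ1⟩ := hT.exists_functional
    refine ⟨Φ, Ψ, hΦ, hΨ, fun G hG p hp => ?_⟩
    obtain ⟨p', hp', hS', hT'⟩ := h p hp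
    obtain ⟨q, hq, hqg⟩ := hG p' hp'
    obtain ⟨r, hr, hTr⟩ := hT' q hqg
    exact ⟨r, mem_comp_comp.2 ⟨p', (hΦ1 _ _).2 hS', q, hq, (hΨ1 _ _).2 hTr⟩, hr⟩

theorem SWReducible.refl (f : Problem) : SWReducible f f := by
  obtain ⟨S, hS, h⟩ := exists_id
  exact sWReducible_iff.2 ⟨S, S, hS, hS, fun p hp => ⟨p, hp, h p, fun q hq => ⟨q, hq, h q⟩⟩⟩

theorem SWReducible.trans {f g h : Problem} (hfg : SWReducible f g) (hgh : SWReducible g h) :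
    SWReducible f h := by
  obtain ⟨S, T, hS, hT, h1⟩ := sWReducible_iff.1 hfg
  obtain ⟨S', T', hS', hT', h2⟩ := sWReducible_iff.1 hgh
  obtain ⟨U, hU, hU1⟩ := hS'.exists_comp hS
  obtain ⟨V, hV, hV1⟩ := hT.exists_comp hT'
  refine sWReducible_iff.2 ⟨U, V, hU, hV, fun p hp => ?_⟩
  obtain ⟨p', hp', hS1, hT1⟩ := h1 p hp
  obtain ⟨p'', hp'', hS2, hT2⟩ := h2 p' hp'
  refine ⟨p'', hp'', hU1 _ _ _ hS1 hS2, fun q hq => ?_⟩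
  obtain ⟨r, hr, hr1⟩ := hT2 q hq
  obtain ⟨w, hw, hw1⟩ := hT1 r hr
  exact ⟨w, hw, hV1 _ _ _ hr1 hw1⟩

/-- Problems are preordered by strong Weihrauch reducibility. -/
instance : Preorder Problem where
  le := SWReducible
  le_refl := SWReducible.refl
  le_trans _ _ _ := SWReducible.trans

theorem meet_dom {f g : Problem} {r : Cantor} (hr : r ∈ (meet f g).dom) :
    ∃ p₀ ∈ f.dom, ∃ p₁ ∈ g.dom, r = cjoin p₀ p₁ := by
  obtain ⟨w, p₀, h0, p₁, h1, e, -⟩ := hr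
  exact ⟨p₀, h0, p₁, h1, e⟩

theorem meet_le_left (f g : Problem) : meet f g ≤ f := by
  obtain ⟨S, hS, h1⟩ := exists_fst
  obtain ⟨T, hT, h2⟩ := exists_addTag 0
  refine sWReducible_iff.2 ⟨S, T, hS, hT, fun r hr => ?_⟩
  obtain ⟨p₀, h0, p₁, h1', rfl⟩ := meet_dom hr
  exact ⟨p₀, h0, h1 _ _, fun q hq =>
    ⟨_, ⟨p₀, h0, p₁, h1', rfl, Or.inl ⟨q, hq, rfl⟩⟩, h2 q⟩⟩

theorem meet_le_right (f g : Problem) : meet f g ≤ g := by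
  obtain ⟨S, hS, h1⟩ := exists_snd
  obtain ⟨T, hT, h2⟩ := exists_addTag 1
  refine sWReducible_iff.2 ⟨S, T, hS, hT, fun r hr => ?_⟩
  obtain ⟨p₀, h0, p₁, h1', rfl⟩ := meet_dom hr
  exact ⟨p₁, h1', h1 _ _, fun q hq =>
    ⟨_, ⟨p₀, h0, p₁, h1', rfl, Or.inr ⟨q, hq, rfl⟩⟩, h2 q⟩⟩

theorem le_meet {f g h : Problem} (hf : h ≤ f) (hg : h ≤ g) : h ≤ meet f g := by
  obtain ⟨S, T, hS, hT, h1⟩ := sWReducible_iff.1 hf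
  obtain ⟨S', T', hS', hT', h2⟩ := sWReducible_iff.1 hg
  obtain ⟨U, hU, hU1⟩ := exists_cjoin hS hS'
  obtain ⟨V, hV, hV0, hV1⟩ := exists_cases hT hT'
  refine sWReducible_iff.2 ⟨U, V, hU, hV, fun p hp => ?_⟩
  obtain ⟨p₀, hp₀, hS1, hT1⟩ := h1 p hp
  obtain ⟨p₁, hp₁, hS2, hT2⟩ := h2 p hp
  refine ⟨cjoin p₀ p₁, ?_, hU1 _ _ _ hS1 hS2, ?_⟩
  · obtain ⟨q, hq⟩ := hp₀
    exact ⟨_, p₀, ⟨q, hq⟩, p₁, hp₁, rfl, Or.inl ⟨q, hq, rfl⟩⟩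
  · rintro w ⟨x₀, -, x₁, -, e, hw⟩
    obtain ⟨rfl, rfl⟩ := cjoin_inj e
    rcases hw with ⟨q, hq, rfl⟩ | ⟨q, hq, rfl⟩
    · obtain ⟨r, hr, hr1⟩ := hT1 q hq
      exact ⟨r, hr, hV0 _ _ hr1⟩
    · obtain ⟨r, hr, hr1⟩ := hT2 q hq
      exact ⟨r, hr, hV1 _ _ hr1⟩

theorem exists_mem_approxEval (y : Cantor) : ∃ a, y ∈ approxEval a := by
  obtain ⟨S, hS, h⟩ := exists_id
  obtain ⟨A, -, hA⟩ := exists_approx hS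
  obtain ⟨a, -, ha⟩ := hA y
  exact ⟨a, ha y (h y)⟩

theorem le_boxplus_left (f g : Problem) : f ≤ boxplus f g := by
  obtain ⟨S, hS, hS1⟩ := exists_addTag 0
  obtain ⟨P, hP, hP1⟩ := exists_fst
  obtain ⟨E, hE, hE1⟩ := exists_eval
  obtain ⟨T, hT, hT1⟩ := hE.exists_comp hP
  refine sWReducible_iff.2 ⟨S, T, hS, hT, fun p hp => ⟨cjoin (tag 0) p, ?_, hS1 p, ?_⟩⟩
  · obtain ⟨y, hy⟩ := hp
    obtain ⟨a, ha⟩ := exists_mem_approxEval y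
    exact ⟨cjoin a a, a, a, rfl, Or.inl ⟨p, rfl, y, ha, hy⟩⟩
  · rintro w ⟨a, b, rfl, ⟨p', e, y, hy, hyf⟩ | ⟨p', e, -⟩⟩
    · obtain ⟨-, rfl⟩ := cjoin_inj e
      exact ⟨y, hyf, hT1 _ _ _ (hP1 a b) (hE1 a y hy)⟩
    · exact absurd (cjoin_inj e).1 tag_ne

theorem le_boxplus_right (f g : Problem) : g ≤ boxplus f g := by
  obtain ⟨S, hS, hS1⟩ := exists_addTag 1
  obtain ⟨P, hP, hP1⟩ := exists_snd
  obtain ⟨E, hE, hE1⟩ := exists_eval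
  obtain ⟨T, hT, hT1⟩ := hE.exists_comp hP
  refine sWReducible_iff.2 ⟨S, T, hS, hT, fun p hp => ⟨cjoin (tag 1) p, ?_, hS1 p, ?_⟩⟩
  · obtain ⟨y, hy⟩ := hp
    obtain ⟨a, ha⟩ := exists_mem_approxEval y
    exact ⟨cjoin a a, a, a, rfl, Or.inr ⟨p, rfl, y, ha, hy⟩⟩
  · rintro w ⟨a, b, rfl, ⟨p', e, -⟩ | ⟨p', e, y, hy, hyg⟩⟩
    · exact absurd (cjoin_inj e).1.symm tag_ne
    · obtain ⟨-, rfl⟩ := cjoin_inj e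
      exact ⟨y, hyg, hT1 _ _ _ (hP1 a b) (hE1 b y hy)⟩

theorem boxplus_le {f g h : Problem} (hf : f ≤ h) (hg : g ≤ h) : boxplus f g ≤ h := by
  obtain ⟨S, T, hS, hT, h1⟩ := sWReducible_iff.1 hf
  obtain ⟨S', T', hS', hT', h2⟩ := sWReducible_iff.1 hg
  obtain ⟨U, hU, hU0, hU1⟩ := exists_cases hS hS'
  obtain ⟨A, hA, hA1⟩ := exists_approx hT
  obtain ⟨B, hB, hB1⟩ := exists_approx hT'
  obtain ⟨V, hV, hV1⟩ := exists_cjoin hA hB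
  refine sWReducible_iff.2 ⟨U, V, hU, hV, ?_⟩
  rintro r ⟨w, -, -, -, ⟨p, rfl, y, -, hy⟩ | ⟨p, rfl, y, -, hy⟩⟩
  · obtain ⟨p', hp', hS1, hT1⟩ := h1 p ⟨y, hy⟩
    refine ⟨p', hp', hU0 _ _ hS1, fun q hq => ?_⟩
    obtain ⟨r, hr, hr1⟩ := hT1 q hq
    obtain ⟨a, ha, ha1⟩ := hA1 q
    obtain ⟨b, hb, -⟩ := hB1 q
    exact ⟨cjoin a b, ⟨a, b, rfl, Or.inl ⟨p, rfl, r, ha1 r hr1, hr⟩⟩, hV1 _ _ _ ha hb⟩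
  · obtain ⟨p', hp', hS1, hT1⟩ := h2 p ⟨y, hy⟩
    refine ⟨p', hp', hU1 _ _ hS1, fun q hq => ?_⟩
    obtain ⟨r, hr, hr1⟩ := hT1 q hq
    obtain ⟨a, ha, -⟩ := hA1 q
    obtain ⟨b, hb, hb1⟩ := hB1 q
    exact ⟨cjoin a b, ⟨a, b, rfl, Or.inr ⟨p, rfl, r, hb1 r hr1, hr⟩⟩, hV1 _ _ _ ha hb⟩

end Problem

/-- The strong Weihrauch degrees: problems up to strong Weihrauch equivalence, with the order
that `≤_sW` induces. -/
abbrev SWDegree : Type := Antisymmetrization Problem (· ≤ ·)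

/-- The strong Weihrauch lattice: the join of the degrees of `f` and `g` is the degree of `f ⊞ g`,
and their meet is the degree of `f ⊓ g`. -/
instance : Lattice SWDegree where
  __ := (inferInstance : PartialOrder SWDegree)
  sup := Quotient.map₂ Problem.boxplus fun _ _ hf _ _ hg =>
    ⟨Problem.boxplus_le (hf.1.trans (Problem.le_boxplus_left _ _))
      (hg.1.trans (Problem.le_boxplus_right _ _)),
     Problem.boxplus_le (hf.2.trans (Problem.le_boxplus_left _ _))
      (hg.2.trans (Problem.le_boxplus_right _ _))⟩
  inf := Quotient.map₂ Problem.meet fun _ _ hf _ _ hg =>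
    ⟨Problem.le_meet ((Problem.meet_le_left _ _).trans hf.1)
      ((Problem.meet_le_right _ _).trans hg.1),
     Problem.le_meet ((Problem.meet_le_left _ _).trans hf.2)
      ((Problem.meet_le_right _ _).trans hg.2)⟩
  le_sup_left a b := Quotient.inductionOn₂ a b fun f g => Problem.le_boxplus_left f g
  le_sup_right a b := Quotient.inductionOn₂ a b fun f g => Problem.le_boxplus_right f g
  sup_le a b c := Quotient.inductionOn₃ a b c fun _ _ _ => Problem.boxplus_le
  inf_le_left a b := Quotient.inductionOn₂ a b fun f g => Problem.meet_le_left f g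
  inf_le_right a b := Quotient.inductionOn₂ a b fun f g => Problem.meet_le_right f g
  le_inf a b c := Quotient.inductionOn₃ a b c fun _ _ _ => Problem.le_meet

/-!
The problem `ofDom A` asks, for an instance in `A`, for nothing but the zero sequence. Between such
problems `≤_sW` is reverse Medvedev reducibility of the domains: one program has to transform every
point of `A` into some point of `B`.

By Stone's representation, `L` is a lattice of sets `K ⊆ ℕ`. Fix a point `x` whose columns are
generic, and let the instances for `K` be the pairs `⟨r k, x with column k erased⟩` for `k ∈ K`,
together with all pairs `⟨R, x⟩`. An instance that lacks column `k` cannot be transformed into one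
that has it, so the degree determines `K`. The coordinatewise maximum of two instances restores
`x` unless both lack the same column, which gives meets; and the bits of `r k` decide to which of
two sets `k` belongs, which gives joins.
-/

/-! ## Countability and continuity of the partial recursive functionals -/

/-- Programs for the functionals in `OracleRec`, with one constructor for each of its rules. They
witness that there are only countably many partial recursive functionals. -/
inductive OracleCode : Type
  | zero : OracleCode
  | succ : OracleCode
  | left : OracleCode
  | right : OracleCode
  | oracle : OracleCode
  | pair : OracleCode → OracleCode → OracleCode
  | comp : OracleCode → OracleCode → OracleCode
  | prec : OracleCode → OracleCode → OracleCode
  | rfind : OracleCode → OracleCode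
  deriving Countable

/-- The functional that an oracle program computes. -/
def OracleCode.eval : OracleCode → Cantor → ℕ →. ℕ
  | zero => fun _ _ => Part.some 0
  | succ => fun _ n => Part.some (n + 1)
  | left => fun _ n => Part.some (Nat.unpair n).1
  | right => fun _ n => Part.some (Nat.unpair n).2
  | oracle => fun p n => Part.some (p n).toNat
  | pair c d => fun p n => (c.eval p n).bind fun a => (d.eval p n).map fun b => Nat.pair a b
  | comp c d => fun p n => (d.eval p n).bind fun a => c.eval p a
  | prec c d => fun p m =>
      Nat.rec (c.eval p (Nat.unpair m).1)
        (fun y IH => IH.bind fun i => d.eval p (Nat.pair (Nat.unpair m).1 (Nat.pair y i)))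
        (Nat.unpair m).2
  | rfind c => fun p a =>
      Nat.rfind fun n => (c.eval p (Nat.pair a n)).map fun m => decide (m = 0)

theorem OracleRec.exists_eval_eq {T : Cantor → ℕ →. ℕ} (hT : OracleRec T) :
    ∃ c : OracleCode, c.eval = T := by
  induction hT with
  | zero => exact ⟨.zero, rfl⟩
  | succ => exact ⟨.succ, rfl⟩
  | left => exact ⟨.left, rfl⟩
  | right => exact ⟨.right, rfl⟩
  | oracle => exact ⟨.oracle, rfl⟩
  | pair _ _ ihf ihh =>
    obtain ⟨⟨c, rfl⟩, ⟨d, rfl⟩⟩ := And.intro ihf ihh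
    exact ⟨.pair c d, rfl⟩
  | comp _ _ ihf ihh =>
    obtain ⟨⟨c, rfl⟩, ⟨d, rfl⟩⟩ := And.intro ihf ihh
    exact ⟨.comp c d, rfl⟩
  | prec _ _ ihf ihh =>
    obtain ⟨⟨c, rfl⟩, ⟨d, rfl⟩⟩ := And.intro ihf ihh
    exact ⟨.prec c d, rfl⟩
  | rfind _ ihf =>
    obtain ⟨c, rfl⟩ := ihf
    exact ⟨.rfind c, rfl⟩

theorem countable_setOf_oracleRec : {T | OracleRec T}.Countable :=
  (Set.countable_range OracleCode.eval).mono fun _ hT => hT.exists_eval_eq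

section PartOpen

variable {X α β : Type*} [TopologicalSpace X] {f : X → Part α}

theorem isOpen_setOf_mem_partBind {g : X → α → Part β} (hf : ∀ a, IsOpen {x | a ∈ f x})
    {b : β} (hg : ∀ a, IsOpen {x | b ∈ g x a}) : IsOpen {x | b ∈ (f x).bind (g x)} := by
  simp only [Part.mem_bind_iff, Set.ofPred_exists, Set.ofPred_and]
  exact isOpen_iUnion fun a => (hf a).inter (hg a)

theorem isOpen_setOf_mem_partMap (h : α → β) (hf : ∀ a, IsOpen {x | a ∈ f x}) (b : β) :
    IsOpen {x | b ∈ (f x).map h} := by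
  simp only [Part.mem_map_iff, Set.ofPred_exists, Set.ofPred_and]
  exact isOpen_iUnion fun a => (hf a).inter isOpen_const

end PartOpen

theorem OracleRec.isOpen_setOf_mem {T : Cantor → ℕ →. ℕ} (hT : OracleRec T) (n v : ℕ) :
    IsOpen {p | v ∈ T p n} := by
  induction hT generalizing n v with
  | zero | succ | left | right => exact isOpen_const
  | oracle =>
    have continuous_eval : Continuous fun p : Cantor => p n := continuous_apply n
    exact (isOpen_discrete {b : Bool | v ∈ Part.some b.toNat}).preimage continuous_eval
  | pair _ _ ihf ihh =>
    exact isOpen_setOf_mem_partBind (ihf n) fun a => isOpen_setOf_mem_partMap _ (ihh n) v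
  | comp _ _ ihf ihh => exact isOpen_setOf_mem_partBind (ihh n) fun a => ihf a v
  | prec _ _ ihf ihh =>
    beta_reduce
    induction (Nat.unpair n).2 generalizing v with
    | zero => exact ihf _ v
    | succ k ih => exact isOpen_setOf_mem_partBind ih fun i => ihh _ v
  | @rfind f _ ihf =>
    let isZero (p : Cantor) (k : ℕ) : Part Bool :=
      (f p (Nat.pair n k)).map fun m => decide (m = 0)
    have isOpen_mem_isZero (k : ℕ) (b : Bool) : IsOpen {p | b ∈ isZero p k} :=
      isOpen_setOf_mem_partMap _ (ihf _) b
    have setOf_mem_rfind : {p | v ∈ Nat.rfind (isZero p)} =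
        {p | true ∈ isZero p v} ∩ ⋂ k ∈ Finset.range v, {p | false ∈ isZero p k} := by
      ext p
      simp only [Set.mem_ofPred_eq, Set.mem_inter_iff, Set.mem_iInter, Finset.mem_range]
      exact mem_rfind_iff
    exact setOf_mem_rfind ▸
      (isOpen_mem_isZero v _).inter (isOpen_biInter_finset fun k _ => isOpen_mem_isZero k _)

/-! ## Genericity -/

theorem tendsto_update_atTop {π : Type*} [TopologicalSpace π] {v : ℕ → ℕ}
    (hv : Function.Injective v) (x : ℕ → π) (b : ℕ → π) :
    Filter.Tendsto (fun n => Function.update x (v n) (b n)) Filter.atTop (nhds x) := by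
  refine tendsto_pi_nhds.2 fun m => tendsto_const_nhds.congr' ?_
  filter_upwards [hv.nat_tendsto_atTop.eventually_gt_atTop m] with n hn
  rw [Function.update_of_ne hn.ne]

section Genericity

variable {w : Cantor → Cantor} {v : ℕ → ℕ}

theorem OracleRec.isNowhereDense_setOf_computes {T : Cantor → ℕ →. ℕ} (hT : OracleRec T)
    (hw : Continuous w) (hv : Function.Injective v)
    (hwv : ∀ x n b, w (Function.update x (v n) b) = w x) :
    IsNowhereDense {x | Computes T (w x) (x ∘ v)} := by
  refine isNowhereDense_iff_forall_notMem_nhds.2 fun x hx hU => ?_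
  -- Flipping a far out bit `v n` of `x` stays in the closure, but makes the prediction of `T` for
  -- this bit wrong, and this remains so in a neighbourhood of the new point.
  obtain ⟨n, hn⟩ := ((tendsto_update_atTop hv x fun n => !x (v n)).eventually hU).exists
  let mispredicted : Set Cantor :=
    {z | (x (v n)).toNat ∈ T (w z) n} ∩ {z | z (v n) = !x (v n)}
  have continuous_eval : Continuous fun z : Cantor => z (v n) := continuous_apply (v n)
  have isOpen_mispredicted : IsOpen mispredicted :=
    ((hT.isOpen_setOf_mem n _).preimage hw).inter
      ((isOpen_discrete {!x (v n)}).preimage continuous_eval)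
  have flip_mem : Function.update x (v n) (!x (v n)) ∈ mispredicted :=
    ⟨by rw [Set.mem_ofPred_eq, hwv]; exact hx n, Function.update_self ..⟩
  obtain ⟨z, ⟨hzT, hzv⟩, hz⟩ := mem_closure_iff.1 hn mispredicted isOpen_mispredicted flip_mem
  have h : (x (v n)).toNat = (z (v n)).toNat := Part.mem_unique hzT (hz n)
  rw [Set.mem_ofPred_eq.mp hzv] at h
  cases hb : x (v n) <;> simp [hb] at h

theorem isMeagre_setOf_exists_computes (hw : Continuous w) (hv : Function.Injective v)
    (hwv : ∀ x n b, w (Function.update x (v n) b) = w x) :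
    IsMeagre {x | ∃ T, OracleRec T ∧ Computes T (w x) (x ∘ v)} := by
  simp only [← exists_prop, Set.ofPred_exists]
  exact isMeagre_biUnion countable_setOf_oracleRec fun T hT =>
    (OracleRec.isNowhereDense_setOf_computes hT hw hv hwv).isMeagre

end Genericity

/-! ## Columns -/

theorem continuous_cjoin (p : Cantor) : Continuous (cjoin p) := by
  refine continuous_pi fun n => ?_
  by_cases h : n % 2 = 0
  · simpa only [cjoin, if_pos h] using continuous_const
  · simpa only [cjoin, if_neg h] using continuous_apply (n / 2)

theorem cjoin_sup_cjoin (p q p' q' : Cantor) :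
    cjoin p q ⊔ cjoin p' q' = cjoin (p ⊔ p') (q ⊔ q') := by
  funext n
  simp only [cjoin, Pi.sup_apply]
  split_ifs <;> rfl

/-- The `k`-th column of a point of Cantor space, viewed as a binary array indexed by pairs. -/
def column (x : Cantor) (k : ℕ) : Cantor := x ∘ Nat.pair k

/-- The point `x` with the entries of its `k`-th column replaced by zeros. -/
def eraseColumn (x : Cantor) (k : ℕ) : Cantor := fun m => if m.unpair.1 = k then false else x m

section EraseColumn

variable (x : Cantor) {k l : ℕ}

theorem eraseColumn_le (k : ℕ) : eraseColumn x k ≤ x := fun m => by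
  rw [eraseColumn]
  split_ifs
  exacts [Bool.false_le _, le_rfl]

theorem eraseColumn_sup_eraseColumn_of_ne (h : k ≠ l) : eraseColumn x k ⊔ eraseColumn x l = x := by
  funext m
  by_cases hm : m.unpair.1 = k
  · simp [eraseColumn, hm, h]
  · exact le_antisymm (sup_le (eraseColumn_le x k m) (eraseColumn_le x l m))
      (le_sup_of_le_left (by simp [eraseColumn, hm]))

theorem column_eraseColumn_of_ne (h : k ≠ l) : column (eraseColumn x l) k = column x k := by
  funext n
  simp [column, eraseColumn, h]

theorem eraseColumn_update_pair (k n : ℕ) (b : Bool) :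
    eraseColumn (Function.update x (Nat.pair k n) b) k = eraseColumn x k := by
  funext m
  by_cases hm : m.unpair.1 = k
  · simp [eraseColumn, hm]
  · have : m ≠ Nat.pair k n := by
      rintro rfl
      simp at hm
    simp [eraseColumn, this]

theorem continuous_eraseColumn (k : ℕ) : Continuous (eraseColumn · k) := by
  refine continuous_pi fun m => ?_
  by_cases h : m.unpair.1 = k
  · simpa only [eraseColumn, if_pos h] using continuous_const
  · simpa only [eraseColumn, if_neg h] using continuous_apply m

end EraseColumn

/-- No column `k` of `x` can be computed from the other columns of `x`, even with the help of the
point `r k`. -/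
def ColumnsIndependent (r : ℕ → Cantor) (x : Cantor) : Prop :=
  ∀ k T, OracleRec T → ¬ Computes T (cjoin (r k) (eraseColumn x k)) (column x k)

theorem exists_columnsIndependent (r : ℕ → Cantor) : ∃ x, ColumnsIndependent r x := by
  have meagre : IsMeagre (⋃ k, {x | ∃ T, OracleRec T ∧
      Computes T (cjoin (r k) (eraseColumn x k)) (column x k)}) :=
    isMeagre_iUnion fun k => isMeagre_setOf_exists_computes
      ((continuous_cjoin _).comp (continuous_eraseColumn k))
      (fun _ _ h => (Nat.pair_eq_pair.1 h).2) fun x n b => by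
        rw [eraseColumn_update_pair]
  obtain ⟨x, hx⟩ := (dense_of_mem_residual meagre).nonempty
  exact ⟨x, fun k T hT h => hx (Set.mem_iUnion.2 ⟨k, T, hT, h⟩)⟩

/-! ## Mass problems -/

/-- Medvedev reducibility of the mass problem `B` to the mass problem `A`: one oracle program
computes from each point of `A` some point of `B`. -/
def MedvedevReducible (B A : Set Cantor) : Prop :=
  ∃ T, OracleRec T ∧ ∀ p ∈ A, ∃ q ∈ B, Computes T p q

theorem MedvedevReducible.of_subset {A B : Set Cantor} (h : A ⊆ B) : MedvedevReducible B A := by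
  obtain ⟨T, hT, hTp⟩ := exists_id
  exact ⟨T, hT, fun p hp => ⟨p, h hp, hTp p⟩⟩

namespace Problem

variable {f g : Problem} {A B : Set Cantor}

/-- The problem with domain `A` whose only solution is the zero sequence, so that its instances
carry all of its difficulty. -/
def ofDom (A : Set Cantor) : Problem where
  sol p := {q | p ∈ A ∧ q = ⊥}

theorem dom_ofDom (A : Set Cantor) : (ofDom A).dom = A :=
  Set.ext fun _ => ⟨fun ⟨_, hp, _⟩ => hp, fun hp => ⟨⊥, hp, rfl⟩⟩

theorem dom_meet (f g : Problem) : (meet f g).dom = Set.image2 cjoin f.dom g.dom := by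
  ext r
  constructor
  · intro hr
    obtain ⟨p₀, h₀, p₁, h₁, rfl⟩ := meet_dom hr
    exact ⟨p₀, h₀, p₁, h₁, rfl⟩
  · rintro ⟨p₀, ⟨q, hq⟩, p₁, h₁, rfl⟩
    exact ⟨cjoin (tag 0) q, p₀, ⟨q, hq⟩, p₁, h₁, rfl, Or.inl ⟨q, hq, rfl⟩⟩

theorem dom_boxplus (f g : Problem) :
    (boxplus f g).dom = cjoin (tag 0) '' f.dom ∪ cjoin (tag 1) '' g.dom := by
  ext r
  constructor
  · rintro ⟨_, a, b, -, ⟨p, rfl, y, -, hy⟩ | ⟨p, rfl, y, -, hy⟩⟩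
    exacts [Or.inl ⟨p, ⟨y, hy⟩, rfl⟩, Or.inr ⟨p, ⟨y, hy⟩, rfl⟩]
  · rintro (⟨p, ⟨y, hy⟩, rfl⟩ | ⟨p, ⟨y, hy⟩, rfl⟩) <;> obtain ⟨a, ha⟩ := exists_mem_approxEval y
    exacts [⟨_, a, a, rfl, Or.inl ⟨p, rfl, y, ha, hy⟩⟩, ⟨_, a, a, rfl, Or.inr ⟨p, rfl, y, ha, hy⟩⟩]

theorem medvedevReducible_dom_of_le (h : f ≤ g) : MedvedevReducible g.dom f.dom := by
  obtain ⟨S, _, hS, -, hST⟩ := sWReducible_iff.1 h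
  refine ⟨S, hS, fun p hp => ?_⟩
  obtain ⟨p', hp', hSp, -⟩ := hST p hp
  exact ⟨p', hp', hSp⟩

theorem ofDom_le_iff : ofDom A ≤ g ↔ MedvedevReducible g.dom A := by
  refine ⟨fun h => dom_ofDom A ▸ medvedevReducible_dom_of_le h, fun ⟨S, hS, hSA⟩ => ?_⟩
  refine sWReducible_iff.2 ⟨S, _, hS, TotalRec.const 0, fun p hp => ?_⟩
  rw [dom_ofDom] at hp
  obtain ⟨p', hp', hSp⟩ := hSA p hp
  exact ⟨p', hp', hSp, fun q _ => ⟨⊥, ⟨hp, rfl⟩, TotalRec.computes fun _ => rfl⟩⟩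

theorem le_ofDom_iff_of_common_solution {T : Cantor → ℕ →. ℕ} (hT : OracleRec T) {q : Cantor}
    (hTq : Computes T ⊥ q) (hq : ∀ p ∈ f.dom, q ∈ f.sol p) :
    f ≤ ofDom B ↔ MedvedevReducible B f.dom := by
  refine ⟨fun h => dom_ofDom B ▸ medvedevReducible_dom_of_le h, fun ⟨S, hS, hSf⟩ => ?_⟩
  refine sWReducible_iff.2 ⟨S, T, hS, hT, fun p hp => ?_⟩
  obtain ⟨p', hp', hSp⟩ := hSf p hp
  refine ⟨p', (dom_ofDom B).symm ▸ hp', hSp, ?_⟩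
  rintro _ ⟨-, rfl⟩
  exact ⟨q, hq p hp, hTq⟩

theorem meet_ofDom_le_ofDom_iff {C : Set Cantor} :
    meet (ofDom A) (ofDom B) ≤ ofDom C ↔ MedvedevReducible C (Set.image2 cjoin A B) := by
  obtain ⟨T, hT, hTq⟩ := exists_addTag 0
  rw [le_ofDom_iff_of_common_solution hT (hTq ⊥), dom_meet, dom_ofDom, dom_ofDom]
  intro r hr
  obtain ⟨p₀, h₀, p₁, h₁, rfl⟩ := meet_dom hr
  exact ⟨p₀, h₀, p₁, h₁, rfl, Or.inl ⟨⊥, ⟨dom_ofDom A ▸ h₀, rfl⟩, rfl⟩⟩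

end Problem

/-- The strong Weihrauch degree of the problem `ofDom A`. It embeds the mass problems, ordered by
the reverse of Medvedev reducibility, into the strong Weihrauch degrees. -/
def massDegree (A : Set Cantor) : SWDegree := toAntisymmetrization (· ≤ ·) (Problem.ofDom A)

section MassDegree

variable {A B C : Set Cantor}

theorem massDegree_le_iff : massDegree A ≤ massDegree B ↔ MedvedevReducible B A :=
  Problem.ofDom_le_iff.trans (by rw [Problem.dom_ofDom])

theorem massDegree_mono : Monotone massDegree := fun _ _ h =>
  massDegree_le_iff.2 (.of_subset h)

theorem massDegree_le_sup_iff : massDegree C ≤ massDegree A ⊔ massDegree B ↔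
    MedvedevReducible (cjoin (tag 0) '' A ∪ cjoin (tag 1) '' B) C :=
  Problem.ofDom_le_iff.trans
    (by rw [Problem.dom_boxplus, Problem.dom_ofDom, Problem.dom_ofDom])

theorem inf_massDegree_le_iff : massDegree A ⊓ massDegree B ≤ massDegree C ↔
    MedvedevReducible C (Set.image2 cjoin A B) :=
  Problem.meet_ofDom_le_ofDom_iff

end MassDegree

/-! ## Erasing columns of an independent point -/

/-- The points `⟨r k, x with column k erased⟩` for `k ∈ K`, together with the points `⟨R, x⟩` for
all `R`. The latter belong to each of these sets, since they have to serve as a common value when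
two different columns are known to be erasable. -/
def erasures (r : ℕ → Cantor) (x : Cantor) (K : Set ℕ) : Set Cantor :=
  (fun k => cjoin (r k) (eraseColumn x k)) '' K ∪ Set.range (cjoin · x)

theorem exists_computes_sup : ∃ T, OracleRec T ∧ ∀ p q, Computes T (cjoin p q) (p ⊔ q) := by
  have double : Computable fun n : ℕ => 2 * n := Primrec.nat_double.to_comp
  refine ⟨_, (TotalRec.oracle.comp (TotalRec.of_computable double)).ite
    (TotalRec.oracle.comp (TotalRec.of_computable double).succ) (TotalRec.const 1),
    fun p q => TotalRec.computes fun n => ?_⟩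
  rw [cjoin_two_mul, cjoin_two_mul_add_one, Pi.sup_apply]
  cases p n <;> rfl

theorem exists_computes_column (k : ℕ) :
    ∃ T, OracleRec T ∧ ∀ p q, Computes T (cjoin p q) (column q k) := by
  obtain ⟨P, hP, hPq⟩ := exists_snd
  obtain ⟨T, hT, hTP⟩ := OracleRec.exists_comp
    (TotalRec.oracle.comp ((TotalRec.const k).pair TotalRec.id)) hP
  exact ⟨T, hT, fun p q => hTP _ _ _ (hPq p q) (TotalRec.computes fun _ => rfl)⟩

theorem exists_computes_tag_of_bit (c : ℕ) : ∃ T, OracleRec T ∧ ∀ p q,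
    Computes T (cjoin p q) (cjoin (tag (if p c = true then 0 else 1)) (cjoin p q)) := by
  obtain ⟨S₀, hS₀, hS₀p⟩ := exists_addTag 0
  obtain ⟨S₁, hS₁, hS₁p⟩ := exists_addTag 1
  obtain ⟨T, hT, hT₁, hT₀⟩ :=
    OracleRec.cond (TotalRec.oracle.comp (TotalRec.const (2 * c))) hS₁ hS₀
  refine ⟨T, hT, fun p q n => ?_⟩
  by_cases hc : p c = true
  · rw [hT₀ _ n (by simp [cjoin_two_mul, hc]), if_pos hc]
    exact hS₀p _ n
  · rw [hT₁ _ n (by simp [cjoin_two_mul, hc]), if_neg hc]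
    exact hS₁p _ n

section Erasures

variable {r : ℕ → Cantor} {x : Cantor} {K K' : Set ℕ}

theorem erasures_mono : Monotone (erasures r x) := fun _ _ h =>
  Set.union_subset_union_left _ (Set.image_mono h)

theorem sup_mem_erasures {p q : Cantor} (hp : p ∈ erasures r x K) (hq : q ∈ erasures r x K') :
    p ⊔ q ∈ erasures r x (K ∩ K') := by
  rcases hp with ⟨k, hk, rfl⟩ | ⟨R, rfl⟩ <;> rcases hq with ⟨l, hl, rfl⟩ | ⟨R', rfl⟩
  · by_cases hkl : k = l
    · subst hkl
      exact Or.inl ⟨k, ⟨hk, hl⟩, (sup_idem _).symm⟩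
    · simp only [cjoin_sup_cjoin, eraseColumn_sup_eraseColumn_of_ne x hkl]
      exact Or.inr ⟨_, rfl⟩
  · simp only [cjoin_sup_cjoin, sup_eq_right.2 (eraseColumn_le x k)]
    exact Or.inr ⟨_, rfl⟩
  · simp only [cjoin_sup_cjoin, sup_eq_left.2 (eraseColumn_le x l)]
    exact Or.inr ⟨_, rfl⟩
  · simp only [cjoin_sup_cjoin, sup_idem]
    exact Or.inr ⟨_, rfl⟩

theorem medvedevReducible_erasures_inter : MedvedevReducible (erasures r x (K ∩ K'))
    (Set.image2 cjoin (erasures r x K) (erasures r x K')) := by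
  obtain ⟨T, hT, hTsup⟩ := exists_computes_sup
  refine ⟨T, hT, ?_⟩
  rintro _ ⟨p, hp, q, hq, rfl⟩
  exact ⟨p ⊔ q, sup_mem_erasures hp hq, hTsup p q⟩

theorem medvedevReducible_erasures_union {c : ℕ} (hc : ∀ k, r k c = true ↔ k ∈ K) :
    MedvedevReducible (cjoin (tag 0) '' erasures r x K ∪ cjoin (tag 1) '' erasures r x K')
      (erasures r x (K ∪ K')) := by
  obtain ⟨T, hT, hTtag⟩ := exists_computes_tag_of_bit c
  refine ⟨T, hT, ?_⟩
  rintro _ (⟨k, hk, rfl⟩ | ⟨R, rfl⟩) <;> refine ⟨_, ?_, hTtag _ _⟩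
  · by_cases hkK : k ∈ K
    · rw [if_pos ((hc k).2 hkK)]
      exact Or.inl ⟨_, Or.inl ⟨k, hkK, rfl⟩, rfl⟩
    · rw [if_neg (mt (hc k).1 hkK)]
      exact Or.inr ⟨_, Or.inl ⟨k, hk.resolve_left hkK, rfl⟩, rfl⟩
  · split_ifs
    exacts [Or.inl ⟨_, Or.inr ⟨R, rfl⟩, rfl⟩, Or.inr ⟨_, Or.inr ⟨R, rfl⟩, rfl⟩]

theorem exists_column_eq_of_mem_erasures {k : ℕ} (hk : k ∉ K) {p : Cantor}
    (hp : p ∈ erasures r x K) : ∃ R y, p = cjoin R y ∧ column y k = column x k := by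
  rcases hp with ⟨l, hl, rfl⟩ | ⟨R, rfl⟩
  · exact ⟨r l, _, rfl, column_eraseColumn_of_ne x (ne_of_mem_of_not_mem hl hk).symm⟩
  · exact ⟨R, x, rfl, rfl⟩

theorem ColumnsIndependent.medvedevReducible_erasures_iff (hx : ColumnsIndependent r x) :
    MedvedevReducible (erasures r x K') (erasures r x K) ↔ K ⊆ K' := by
  refine ⟨fun ⟨S, hS, hSK⟩ k hk => ?_, fun h => .of_subset (erasures_mono h)⟩
  by_contra hk'
  obtain ⟨_, hp, hSp⟩ := hSK _ (Or.inl ⟨k, hk, rfl⟩)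
  obtain ⟨R, y, rfl, hy⟩ := exists_column_eq_of_mem_erasures hk' hp
  obtain ⟨C, hC, hCy⟩ := exists_computes_column k
  obtain ⟨T, hT, hTCS⟩ := hC.exists_comp hS
  exact hx k T hT (hTCS _ _ _ hSp (hy ▸ hCy R y))

theorem massDegree_erasures_inter : massDegree (erasures r x (K ∩ K')) =
    massDegree (erasures r x K) ⊓ massDegree (erasures r x K') :=
  le_antisymm ((massDegree_mono.comp erasures_mono).map_inf_le K K')
    (inf_massDegree_le_iff.2 medvedevReducible_erasures_inter)

theorem massDegree_erasures_union {c : ℕ} (hc : ∀ k, r k c = true ↔ k ∈ K) :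
    massDegree (erasures r x (K ∪ K')) =
      massDegree (erasures r x K) ⊔ massDegree (erasures r x K') :=
  le_antisymm (massDegree_le_sup_iff.2 (medvedevReducible_erasures_union hc))
    ((massDegree_mono.comp erasures_mono).le_map_sup K K')

theorem ColumnsIndependent.massDegree_erasures_injective (hx : ColumnsIndependent r x) :
    Function.Injective fun K => massDegree (erasures r x K) := fun _ _ h =>
  Set.Subset.antisymm
    (hx.medvedevReducible_erasures_iff.1 (massDegree_le_iff.1 h.le))
    (hx.medvedevReducible_erasures_iff.1 (massDegree_le_iff.1 h.ge))

end Erasures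

/-! ## Representation of countable distributive lattices -/

theorem exists_isPrime_notMem_mem_of_not_le {L : Type*} [DistribLattice L] {a b : L}
    (h : ¬ a ≤ b) : ∃ J : Order.Ideal L, J.IsPrime ∧ a ∉ J ∧ b ∈ J := by
  have disjoint : Disjoint (Order.PFilter.principal a : Set L) (Order.Ideal.principal b : Set L) :=
    Set.disjoint_left.2 fun x hax hxb =>
      h ((Order.PFilter.mem_principal.1 hax).trans (Order.Ideal.mem_principal.1 hxb))
  obtain ⟨J, hJ, hbJ, haJ⟩ := DistribLattice.prime_ideal_of_disjoint_filter_ideal disjoint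
  exact ⟨J, hJ, Set.disjoint_left.1 haJ (Order.PFilter.mem_principal.2 le_rfl),
    hbJ (Order.Ideal.mem_principal.2 le_rfl)⟩

/-- The Stone map of a family of prime ideals, which sends `a` to the set of those members of the
family that do not contain `a`. -/
def stoneHom {L ι : Type*} [Lattice L] (J : ι → Order.Ideal L) (hJ : ∀ j, (J j).IsPrime) :
    LatticeHom L (Set ι) where
  toFun a := {j | a ∉ J j}
  map_sup' a b := by
    ext j
    simp only [Order.Ideal.sup_mem_iff, not_and_or, Set.sup_eq_union, Set.mem_union,
      Set.mem_ofPred_eq]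
  map_inf' a b := by
    ext j
    have inf_mem_iff : a ⊓ b ∈ J j ↔ a ∈ J j ∨ b ∈ J j :=
      ⟨(hJ j).mem_or_mem, Or.rec ((J j).lower inf_le_left) ((J j).lower inf_le_right)⟩
    simp only [inf_mem_iff, not_or, Set.inf_eq_inter, Set.mem_inter_iff, Set.mem_ofPred_eq]

theorem exists_injective_latticeHom_setNat (L : Type*) [DistribLattice L] [Countable L] :
    ∃ φ : LatticeHom L (Set ℕ), Function.Injective φ := by
  choose J hJ haJ hbJ using fun j : {ab : L × L // ¬ ab.1 ≤ ab.2} =>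
    exists_isPrime_notMem_mem_of_not_le j.2
  have stone_injective : Function.Injective (stoneHom J hJ) := fun a b h => by
    have le_of_subset : ∀ a b, stoneHom J hJ a ⊆ stoneHom J hJ b → a ≤ b := fun a b hab =>
      by_contra fun hle => hab (haJ ⟨(a, b), hle⟩) (hbJ ⟨(a, b), hle⟩)
    exact le_antisymm (le_of_subset a b h.subset) (le_of_subset b a h.superset)
  obtain ⟨e, he⟩ := exists_injective_nat {ab : L × L // ¬ ab.1 ≤ ab.2}
  let image : LatticeHom (Set _) (Set ℕ) :=
    { toFun := Set.image e
      map_sup' := Set.image_union e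
      map_inf' := fun _ _ => Set.image_inter he }
  exact ⟨image.comp (stoneHom J hJ), he.image_injective.comp stone_injective⟩

theorem exists_membershipTable {ι : Type*} [Countable ι] (K : ι → Set ℕ) :
    ∃ r : ℕ → Cantor, ∀ i, ∃ c, ∀ k, r k c = true ↔ k ∈ K i := by
  classical
  obtain ⟨e, he⟩ := exists_injective_nat ι
  refine ⟨fun k c => decide (∃ i, e i = c ∧ k ∈ K i), fun i => ⟨e i, fun k => ?_⟩⟩
  simp only [decide_eq_true_eq, he.eq_iff, exists_eq_left]

theorem mainTheorem7 (L : Type*) [DistribLattice L] [Countable L] :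
    ∃ φ : LatticeHom L SWDegree, Function.Injective φ := by
  obtain ⟨φ, hφ⟩ := exists_injective_latticeHom_setNat L
  obtain ⟨r, hr⟩ := exists_membershipTable φ
  obtain ⟨x, hx⟩ := exists_columnsIndependent r
  let ψ : LatticeHom L SWDegree :=
    { toFun := fun a => massDegree (erasures r x (φ a))
      map_sup' := fun a b => by
        obtain ⟨c, hc⟩ := hr a
        rw [map_sup]
        exact massDegree_erasures_union hc
      map_inf' := fun a b => by
        rw [map_inf]
        exact massDegree_erasures_inter }
  exact ⟨ψ, hx.massDegree_erasures_injective.comp hφ⟩
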